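/- Let $R=\mathbb{Z}_9+u\mathbb{Z}_9$ with $u^2=u$. Let $p=12r-1$ be a prime, $r\ge 1$, and let $R_p=R[X]/(X^p-1)$. Words $(c_0,\dots,c_{p-1})\in R^p$ are identified with the elements $c_0+c_1X+\cdots+c_{p-1}X^{p-1}$ of $R_p$, so that cyclic codes of length $p$ over $R$ are the ideals of $R_p$. For $f_1,\dots,f_m\in R_p$ let $(f_1,\dots,f_m)$ be the ideal they generate, and let $\mathcal C^\perp=\{y\in R^p : \sum_i y_ic_i=0 \text{ for all } c\in\mathcal C\}$ be the Euclidean dual. Let $\mathcal Q_p$ and $\mathcal N_p$ be the sets of nonzero quadratic residues and of quadratic non-residues modulo $p$, and put in $R_p$ $$Q=\sum_{i\in\mathcal Q_p}X^i,\qquad N=\sum_{i\in\mathcal N_p}X^i,\qquad J=1+Q+N.$$ For $A,B\in R_p$ set $$(d(A,B),\,e(A,B))=\begin{cases}(8A,\ 1+B)& r\equiv 0\pmod 3,\\(3+6A+8B,\ 7+A+3B)& r\equiv 1\pmod 3,\\(6+3A+8B,\ 4+A+6B)& r\equiv 2\pmod 3.\end{cases}$$ The quadratic residue codes of length $p$ over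 $R$ are the ideals $$\mathcal D_1=(u\,d(Q,N)+(1-u)\,d(N,Q)),\qquad \mathcal D_2=(u\,d(N,Q)+(1-u)\,d(Q,N)),$$ $$\mathcal E_1=(u\,e(Q,N)+(1-u)\,e(N,Q)),\qquad \mathcal E_2=(u\,e(N,Q)+(1-u)\,e(Q,N)).$$ For a positive integer $a$ let $\mu_a$ be the $R$-linear map on $R_p$ with $X^i\mapsto X^{ai}$, and write $\mathcal C\mu_a$ for the image of $\mathcal C$ under $\mu_a$. Then the four displayed generators are idempotents of $R_p$, and: (i) If $a$ modulo $p$ is in $\mathcal Q_p$, then $\mathcal D_i\mu_a=\mathcal D_i$ and $\mathcal E_i\mu_a=\mathcal E_i$ for $i=1,2$. If $a$ modulo $p$ is in $\mathcal N_p$, then $\mathcal D_1\mu_a=\mathcal D_2$, $\mathcal D_2\mu_a=\mathcal D_1$, $\mathcal E_1\mu_a=\mathcal E_2$ and $\mathcal E_2\mu_a=\mathcal E_1$. Moreover there is $K\in\{2J,5J,8J\}$ such that (ii), (iii) and (v) hold: (ii) $\mathcal D_1\cap\mathcal D_2=(K)$ and $\mathcal D_1+\mathcal D_2=R_p$. (iii)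 $\mathcal E_1\cap\mathcal E_2=\{0\}$ and $\mathcal E_1+\mathcal E_2=(K)^\perp$. (iv) $|\mathcal D_1|=|\mathcal D_2|=9^{p+1}$ and $|\mathcal E_1|=|\mathcal E_2|=9^{p-1}$. (v) $\mathcal D_i=\mathcal E_i+(K)$ for $i=1,2$. (vi) $\mathcal E_1$ and $\mathcal E_2$ are Euclidean self-orthogonal, that is $\mathcal E_i\subseteq\mathcal E_i^\perp$, and $\mathcal E_i^\perp=\mathcal D_i$ for $i=1,2$. -/

import Mathlib

open Polynomial

noncomputable section

namespace QRCode

/-- The ring `R = ℤ₉ + uℤ₉` with `u² = u` (the quadratic algebra over `ℤ₉` with `u² = 0 + 1·u`). -/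
abbrev R : Type := QuadraticAlgebra (ZMod 9) 0 1

/-- The element `u` of `R`. -/
def u : R := QuadraticAlgebra.omega

/-- The ring `R_n = R[X]/(X^n - 1)`. -/
abbrev Rn (n : ℕ) : Type := AdjoinRoot (X ^ n - 1 : R[X])

/-- The class of `X` in `R_n`. -/
abbrev x (n : ℕ) : Rn n := AdjoinRoot.root (X ^ n - 1 : R[X])

/-- The constant `u` in `R_n`. -/
def uu (n : ℕ) : Rn n := algebraMap R (Rn n) u

theorem x_pow (n : ℕ) : x n ^ n = 1 := by
  have h := AdjoinRoot.eval₂_root (X ^ n - 1 : R[X])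
  rw [eval₂_sub, eval₂_X_pow, eval₂_one] at h
  exact sub_eq_zero.mp h

/-- The identification of words with polynomials: `(c₀, …, c_{n-1}) ↦ c₀ + c₁X + ⋯ + c_{n-1}X^{n-1}`. -/
def phi (n : ℕ) (c : Fin n → R) : Rn n :=
  ∑ i : Fin n, algebraMap R (Rn n) (c i) * x n ^ (i : ℕ)

/-- The Euclidean dual of a set of words of length `n`. -/
def dualWords {n : ℕ} (C : Set (Fin n → R)) : Set (Fin n → R) :=
  {y | ∀ c ∈ C, ∑ i, y i * c i = 0}

/-- The Euclidean dual of a subset of `R_n`, words being identified with polynomials by `phi`. -/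
def dual {n : ℕ} (C : Set (Rn n)) : Set (Rn n) :=
  phi n '' dualWords (phi n ⁻¹' C)

/-- The map `μ_a` on `R_n`: it fixes the coefficients and sends `X^i` to `X^{a i}`. -/
def mu (n a : ℕ) : Rn n →+* Rn n :=
  AdjoinRoot.lift (algebraMap R (Rn n)) (x n ^ a) (by
    rw [eval₂_sub, eval₂_X_pow, eval₂_one, ← pow_mul, mul_comm, pow_mul, x_pow, one_pow, sub_self])

/-- `a` represents a nonzero quadratic residue modulo `p`. -/
def IsResidue (p a : ℕ) : Prop := (a : ZMod p) ≠ 0 ∧ IsSquare (a : ZMod p)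

/-- `a` represents a quadratic non-residue modulo `p`. -/
def IsNonresidue (p a : ℕ) : Prop := ¬ IsSquare (a : ZMod p)

open Classical in
/-- `Q(X) = ∑ X^i` over the nonzero quadratic residues `i` modulo `p`. -/
def Q (p : ℕ) : Rn p := ∑ i ∈ (Finset.range p).filter (IsResidue p), x p ^ i

open Classical in
/-- `N(X) = ∑ X^i` over the quadratic non-residues `i` modulo `p`. -/
def N (p : ℕ) : Rn p := ∑ i ∈ (Finset.range p).filter (IsNonresidue p), x p ^ i

/-- `J(X) = 1 + Q(X) + N(X)`. -/
def J (p : ℕ) : Rn p := 1 + Q p + N p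

/-- The building block of the idempotents of the codes `𝒟ᵢ`. -/
def dBlock {p : ℕ} (r : ℕ) (A B : Rn p) : Rn p :=
  if r % 3 = 0 then 8 * A
  else if r % 3 = 1 then 3 + 6 * A + 8 * B
  else 6 + 3 * A + 8 * B

/-- The building block of the idempotents of the codes `ℰᵢ`. -/
def eBlock {p : ℕ} (r : ℕ) (A B : Rn p) : Rn p :=
  if r % 3 = 0 then 1 + B
  else if r % 3 = 1 then 7 + A + 3 * B
  else 4 + A + 6 * B

/-- Generator of `𝒟₁`. -/
def d₁ (p r : ℕ) : Rn p := uu p * dBlock r (Q p) (N p) + (1 - uu p) * dBlock r (N p) (Q p)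

/-- Generator of `𝒟₂`. -/
def d₂ (p r : ℕ) : Rn p := uu p * dBlock r (N p) (Q p) + (1 - uu p) * dBlock r (Q p) (N p)

/-- Generator of `ℰ₁`. -/
def e₁ (p r : ℕ) : Rn p := uu p * eBlock r (Q p) (N p) + (1 - uu p) * eBlock r (N p) (Q p)

/-- Generator of `ℰ₂`. -/
def e₂ (p r : ℕ) : Rn p := uu p * eBlock r (N p) (Q p) + (1 - uu p) * eBlock r (Q p) (N p)

/-- The quadratic residue code `𝒟₁` of length `p = 12r - 1`. -/
def D₁ (p r : ℕ) : Ideal (Rn p) := Ideal.span {d₁ p r}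

/-- The quadratic residue code `𝒟₂` of length `p = 12r - 1`. -/
def D₂ (p r : ℕ) : Ideal (Rn p) := Ideal.span {d₂ p r}

/-- The quadratic residue code `ℰ₁` of length `p = 12r - 1`. -/
def E₁ (p r : ℕ) : Ideal (Rn p) := Ideal.span {e₁ p r}

/-- The quadratic residue code `ℰ₂` of length `p = 12r - 1`. -/
def E₂ (p r : ℕ) : Ideal (Rn p) := Ideal.span {e₂ p r}

/-- The image `Cμ_a` of a code `C` under `μ_a`. -/
def image {n : ℕ} (a : ℕ) (C : Ideal (Rn n)) : Set (Rn n) := mu n a '' (C : Set (Rn n))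

end QRCode

end

open Polynomial

noncomputable section

namespace QRCode

/-! ### Words, the inner product and duals of ideals -/

section Words

/-! Everything follows from four identities: with K = cJ and c = 1/p mod 9, d₁ and d₂ are
idempotents with d₁d₂ = K and d₁ + d₂ = 1 + K (`d_relations`), while e₁ = 1 - d₂ and e₂ = 1 - d₁.

They come from Gauss sums. For T = Q - N one has J² = pJ, JT = 0 and T² = J - p, as p ≡ 3 mod 4. If
t² = -c, then w = cJ + tT satisfies w² = 1, and the two blocks are (1 + cJ ± tT)/2, with 1/2 = 5.
Mixing them by u and 1 - u keeps the relations.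

The map μ_a fixes J and multiplies T by the quadratic character of a, so it fixes or swaps d₁ and
d₂. The dual of (e), e idempotent, is (1 - μ₋₁e) (`dual_span_idem`). As -1 is a non-residue, E₁ has
dual (1 - e₂) = D₁. The sizes follow from the decompositions D₁ = E₁ ⊕ (K) and R_p = E₁ ⊕ D₂. -/

theorem monic_X_pow_sub_one {n : ℕ} (hn : n ≠ 0) : (X ^ n - 1 : R[X]).Monic :=
  monic_X_pow_sub_C (1 : R) hn

instance : Nontrivial R :=
  ⟨0, 1, fun h => absurd (congrArg QuadraticAlgebra.re h) (by decide)⟩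

theorem natDegree_X_pow_sub_one (n : ℕ) : (X ^ n - 1 : R[X]).natDegree = n :=
  natDegree_X_pow_sub_C (r := (1 : R))

/-- The monomials `1, X, …, X^{n-1}` form a basis of `R_n`. -/
def monomialBasis (n : ℕ) [NeZero n] : Module.Basis (Fin n) R (Rn n) :=
  (AdjoinRoot.powerBasis' (monic_X_pow_sub_one (NeZero.ne n))).basis.reindex
    (finCongr (natDegree_X_pow_sub_one n))

theorem monomialBasis_apply (n : ℕ) [NeZero n] (i : Fin n) :
    monomialBasis n i = x n ^ (i : ℕ) := by
  rw [monomialBasis, Module.Basis.reindex_apply, PowerBasis.basis_eq_pow]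
  rfl

theorem phi_eq (n : ℕ) [NeZero n] (c : Fin n → R) :
    phi n c = (monomialBasis n).equivFun.symm c := by
  rw [Module.Basis.equivFun_symm_apply, phi]
  exact Finset.sum_congr rfl fun i _ => by rw [monomialBasis_apply, Algebra.smul_def]

theorem phi_bijective (n : ℕ) [NeZero n] : Function.Bijective (phi n) := by
  have : phi n = (monomialBasis n).equivFun.symm := funext (phi_eq n)
  rw [this]
  exact LinearEquiv.bijective _

theorem x_pow_mod (n k : ℕ) : x n ^ (k % n) = x n ^ k := by
  conv_rhs => rw [← Nat.div_add_mod k n, pow_add, pow_mul, x_pow, one_pow, one_mul]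

theorem x_pow_congr {n j k : ℕ} (h : (j : ZMod n) = k) : x n ^ j = x n ^ k := by
  rw [← x_pow_mod n j, ← x_pow_mod n k, (ZMod.natCast_eq_natCast_iff j k n).1 h]

/-- The constant coefficient of an element of `R_n`. -/
def constCoeff (n : ℕ) [NeZero n] : Rn n →ₗ[R] R := (monomialBasis n).coord 0

theorem constCoeff_x_pow (n : ℕ) [NeZero n] (k : ℕ) :
    constCoeff n (x n ^ k) = if (k : ZMod n) = 0 then 1 else 0 := by
  have hk : k % n < n := Nat.mod_lt _ (NeZero.pos n)
  have h : x n ^ k = monomialBasis n ⟨k % n, hk⟩ := by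
    rw [monomialBasis_apply, x_pow_mod]
  rw [h, constCoeff, Module.Basis.coord_apply, Module.Basis.repr_self, Finsupp.single_apply]
  simp only [Fin.ext_iff, Fin.val_zero, ZMod.natCast_eq_zero_iff, Nat.dvd_iff_mod_eq_zero]

theorem mu_algebraMap (n a : ℕ) (s : R) : mu n a (algebraMap R (Rn n) s) = algebraMap R (Rn n) s :=
  AdjoinRoot.lift_of _

theorem mu_x (n a : ℕ) : mu n a (x n) = x n ^ a := AdjoinRoot.lift_root _

theorem mu_uu (n a : ℕ) : mu n a (uu n) = uu n := mu_algebraMap n a u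

theorem mu_phi (n a : ℕ) (c : Fin n → R) :
    mu n a (phi n c) = ∑ i : Fin n, algebraMap R (Rn n) (c i) * x n ^ (a * (i : ℕ)) := by
  simp only [phi, map_sum, map_mul, mu_algebraMap, map_pow, mu_x, ← pow_mul]

theorem mu_mu {n a b : ℕ} (hn : n ≠ 0) (h : (a : ZMod n) * b = 1) (z : Rn n) : mu n a (mu n b z) = z := by
  have : NeZero n := ⟨hn⟩
  obtain ⟨c, rfl⟩ := (phi_bijective n).2 z
  rw [mu_phi]
  simp only [phi, map_sum, map_mul, mu_algebraMap, map_pow, mu_x, ← pow_mul]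
  refine Finset.sum_congr rfl fun i _ => ?_
  rw [x_pow_congr (j := a * (b * (i : ℕ))) (k := i)]
  push_cast
  rw [← mul_assoc, h, one_mul]

/-- Since n - 1 represents -1, `mu n (n - 1)` inverts X, and only equal exponents meet in degree 0.
-/
theorem constCoeff_phi_mul_mu_phi (n : ℕ) [NeZero n] (c d : Fin n → R) :
    constCoeff n (phi n c * mu n (n - 1) (phi n d)) = ∑ i, c i * d i := by
  have hc : ((n - 1 : ℕ) : ZMod n) = -1 := by
    rw [Nat.cast_sub (NeZero.one_le), ZMod.natCast_self, Nat.cast_one, zero_sub]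
  rw [mu_phi, phi, Finset.sum_mul_sum, map_sum]
  refine Finset.sum_congr rfl fun i _ => ?_
  rw [map_sum]
  have h : ∀ j : Fin n, constCoeff n (algebraMap R (Rn n) (c i) * x n ^ (i : ℕ) *
      (algebraMap R (Rn n) (d j) * x n ^ ((n - 1) * (j : ℕ)))) = if i = j then c i * d j else 0 := by
    intro j
    have h1 : algebraMap R (Rn n) (c i) * x n ^ (i : ℕ) *
      (algebraMap R (Rn n) (d j) * x n ^ ((n - 1) * (j : ℕ))) =
        (c i * d j) • x n ^ ((i : ℕ) + (n - 1) * (j : ℕ)) := by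
      rw [Algebra.smul_def, map_mul, pow_add]; ring
    have h2 : (((i : ℕ) + (n - 1) * (j : ℕ) : ℕ) : ZMod n) = 0 ↔ i = j := by
      rw [Nat.cast_add, Nat.cast_mul, hc, neg_one_mul, ← sub_eq_add_neg, sub_eq_zero,
        ZMod.natCast_eq_natCast_iff', Nat.mod_eq_of_lt i.2, Nat.mod_eq_of_lt j.2, Fin.ext_iff]
    rw [h1, map_smul, constCoeff_x_pow]
    simp only [h2, smul_eq_mul, mul_ite, mul_one, mul_zero]
  simp only [h, Finset.sum_ite_eq, Finset.mem_univ, if_true]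

theorem mem_dual_iff {n : ℕ} [NeZero n] (C : Ideal (Rn n)) (z : Rn n) :
    z ∈ dual (C : Set (Rn n)) ↔ ∀ w ∈ C, z * mu n (n - 1) w = 0 := by
  obtain ⟨y, rfl⟩ := (phi_bijective n).2 z
  rw [dual, (phi_bijective n).1.mem_set_image]
  constructor
  · intro hy w hw
    obtain ⟨s, hs⟩ := (phi_bijective n).2 (phi n y * mu n (n - 1) w)
    rw [← hs]
    suffices s = 0 by subst this; simp [phi]
    funext i
    -- Each coefficient of the product is an inner product with a shift of `w`, and the ideal
    -- contains all shifts.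
    have h1 : s i = constCoeff n (phi n s * mu n (n - 1) (phi n (Pi.single i 1))) := by
      rw [constCoeff_phi_mul_mu_phi]
      simp [Pi.single_apply]
    obtain ⟨c, hc⟩ := (phi_bijective n).2 (w * phi n (Pi.single i 1))
    rw [h1, hs, mul_assoc, ← map_mul, ← hc, constCoeff_phi_mul_mu_phi]
    refine hy c ?_
    rw [Set.mem_preimage, hc]
    exact C.mul_mem_right _ hw
  · intro h c hc
    rw [← constCoeff_phi_mul_mu_phi, h _ hc, map_zero]

theorem mem_span_idem_iff {A : Type*} [CommRing A] {e z : A} (he : e * e = e) :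
    z ∈ Ideal.span {e} ↔ z * e = z := by
  rw [Ideal.mem_span_singleton']
  constructor
  · rintro ⟨a, rfl⟩
    rw [mul_assoc, he]
  · exact fun h => ⟨z, h⟩

theorem dual_span_idem {n : ℕ} [NeZero n] {e f : Rn n} (he : e * e = e)
    (hf : mu n (n - 1) e = f) :
    dual (Ideal.span {e} : Ideal (Rn n)) =
      ((Ideal.span {1 - f} : Ideal (Rn n)) : Set (Rn n)) := by
  have hff : f * f = f := by rw [← hf, ← map_mul, he]
  ext z
  rw [mem_dual_iff, SetLike.mem_coe, mem_span_idem_iff (by linear_combination hff)]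
  constructor
  · intro h
    have := h e (Ideal.mem_span_singleton_self e)
    rw [hf] at this
    rw [mul_sub, mul_one, this, sub_zero]
  · intro h w hw
    rw [mem_span_idem_iff he] at hw
    rw [← hw, map_mul, hf]
    linear_combination (-mu n (n - 1) w * f) * h - z * mu n (n - 1) w * hff

theorem card_R : Nat.card R = 81 := by
  rw [Nat.card_congr (QuadraticAlgebra.equivProd (R := ZMod 9) 0 1), Nat.card_prod, Nat.card_zmod]

theorem card_Rn (n : ℕ) [NeZero n] : Nat.card (Rn n) = 81 ^ n := by
  rw [← Nat.card_congr (Equiv.ofBijective _ (phi_bijective n)), Nat.card_fun, card_R, Nat.card_fin]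

instance (n : ℕ) [NeZero n] : Finite (Rn n) :=
  Nat.finite_of_card_ne_zero (by rw [card_Rn]; positivity)

/-- Supplied to `linear_combination`, this does arithmetic modulo 9. -/
theorem nine_eq_zero {A : Type*} [Ring A] [Algebra R A] : (9 : A) = 0 := by
  have h : (9 : ZMod 9) = 0 := rfl
  have h2 : (9 : R) = 0 := by
    rw [← map_ofNat (algebraMap (ZMod 9) R) 9, h, map_zero]
  rw [← map_ofNat (algebraMap R A) 9, h2, map_zero]

end Words

/-! ### Ideals generated by idempotents -/

section Idempotents
variable {A : Type*} [CommRing A]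

/-- The sum of the two ideals is direct: z splits as ze + zf. -/
theorem card_span_add {e f : A} (he : e * e = e) (hf : f * f = f) (hef : e * f = 0) :
    Nat.card (Ideal.span {e + f}) = Nat.card (Ideal.span {e}) * Nat.card (Ideal.span {f}) := by
  have hs : (e + f) * (e + f) = e + f := by linear_combination he + hf + 2 * hef
  rw [← Nat.card_prod]
  refine (Nat.card_congr (Equiv.ofBijective
    (fun z : Ideal.span {e} × Ideal.span {f} =>
      (⟨z.1 + z.2, ?_⟩ : Ideal.span {e + f})) ⟨?_, ?_⟩)).symm
  · have h1 := (mem_span_idem_iff he).1 z.1.2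
    have h2 := (mem_span_idem_iff hf).1 z.2.2
    rw [mem_span_idem_iff hs]
    linear_combination h1 + h2 + (z.1 : A) * hef + (z.2 : A) * hef - f * h1 - e * h2
  · rintro ⟨⟨a, ha⟩, ⟨b, hb⟩⟩ ⟨⟨c, hc⟩, ⟨d, hd⟩⟩ h
    rw [mem_span_idem_iff he] at ha hc
    rw [mem_span_idem_iff hf] at hb hd
    simp only [Subtype.mk.injEq] at h
    have h1 : a = c := by
      linear_combination e * h - ha + hc + (d - b) * hef + e * hb - e * hd
    simp only [Prod.mk.injEq, Subtype.mk.injEq]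
    exact ⟨h1, by linear_combination h - h1⟩
  · rintro ⟨z, hz⟩
    refine ⟨⟨⟨z * e, Ideal.mem_span_singleton'.2 ⟨z, rfl⟩⟩,
      ⟨z * f, Ideal.mem_span_singleton'.2 ⟨z, rfl⟩⟩⟩, ?_⟩
    rw [mem_span_idem_iff hs] at hz
    simp only [Subtype.mk.injEq]
    linear_combination hz

theorem span_sup_span_idem {e f : A} (he : e * e = e) (hf : f * f = f) (hef : e * f = 0) :
    Ideal.span {e} + Ideal.span {f} = Ideal.span {e + f} := by
  apply le_antisymm
  · rw [Submodule.add_eq_sup, sup_le_iff, Ideal.span_singleton_le_iff_mem,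
      Ideal.span_singleton_le_iff_mem, Ideal.mem_span_singleton', Ideal.mem_span_singleton']
    exact ⟨⟨e, by linear_combination he + hef⟩, ⟨f, by linear_combination hf + hef⟩⟩
  · rw [Ideal.span_singleton_le_iff_mem]
    exact Submodule.add_mem_sup (Ideal.mem_span_singleton_self e) (Ideal.mem_span_singleton_self f)

theorem span_inf_span_idem {e f : A} (he : e * e = e) (hf : f * f = f) :
    Ideal.span {e} ⊓ Ideal.span {f} = Ideal.span {e * f} := by
  ext z
  rw [Ideal.mem_inf, mem_span_idem_iff he, mem_span_idem_iff hf,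
    mem_span_idem_iff (by linear_combination e * e * hf + f * he)]
  constructor
  · rintro ⟨h1, h2⟩
    rw [← mul_assoc, h1, h2]
  · intro h
    exact ⟨by linear_combination (e - 1) * (-h) - z * f * (-he),
      by linear_combination (f - 1) * (-h) + z * e * hf⟩

end Idempotents

/-! ### Gauss sum relations for J and Q - N -/

section GaussSum
variable {p : ℕ} [Fact p.Prime]

/-- The power of `X` in `R_p` with exponent in `ℤ/p`. -/
def xPow (p : ℕ) (i : ZMod p) : Rn p := x p ^ i.val

theorem x_pow_eq_xPow (k : ℕ) : x p ^ k = xPow p k :=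
  x_pow_congr (by rw [ZMod.natCast_zmod_val])

theorem xPow_add (i j : ZMod p) : xPow p (i + j) = xPow p i * xPow p j := by
  rw [xPow, xPow, xPow, ← pow_add]
  exact x_pow_congr (by simp)

theorem xPow_zero : xPow p 0 = 1 := by simp [xPow]

theorem mu_xPow (a : ℕ) (i : ZMod p) : mu p a (xPow p i) = xPow p (a * i) := by
  rw [xPow, map_pow, mu_x, ← pow_mul, xPow]
  exact x_pow_congr (by simp)

theorem sum_range_eq_sum_zmod {M : Type*} [AddCommMonoid M] (f : ZMod p → M) :
    ∑ i ∈ Finset.range p, f i = ∑ i : ZMod p, f i :=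
  Finset.sum_bij' (fun i _ => (i : ZMod p)) (fun j _ => j.val) (by simp)
    (fun j _ => Finset.mem_range.2 j.val_lt)
    (fun i hi => ZMod.val_cast_of_lt (Finset.mem_range.1 hi)) (by simp) (by simp)

/-- The quadratic character modulo `p` with values in `R_p`. -/
def chi (p : ℕ) [Fact p.Prime] (i : ZMod p) : Rn p := ((quadraticChar (ZMod p) i : ℤ) : Rn p)

theorem chi_mul (i j : ZMod p) : chi p (i * j) = chi p i * chi p j := by
  simp only [chi, map_mul, Int.cast_mul]

theorem chi_residue {a : ℕ} (ha : IsResidue p a) : chi p a = 1 := by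
  rw [chi, (quadraticChar_one_iff_isSquare ha.1).2 ha.2, Int.cast_one]

theorem chi_nonresidue {a : ℕ} (ha : IsNonresidue p a) : chi p a = -1 := by
  rw [chi, quadraticChar_neg_one_iff_not_isSquare.2 ha, Int.cast_neg, Int.cast_one]

theorem J_eq_sum : J p = ∑ i : ZMod p, xPow p i := by
  classical
  have h1 : (1 : Rn p) = ∑ i : ZMod p, if i = 0 then xPow p i else 0 := by simp [xPow_zero]
  rw [J, Q, N, Finset.sum_filter, Finset.sum_filter, add_assoc, ← Finset.sum_add_distrib]
  simp only [IsResidue, IsNonresidue, x_pow_eq_xPow]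
  rw [sum_range_eq_sum_zmod fun i => (if i ≠ 0 ∧ IsSquare i then xPow p i else 0) +
    if ¬ IsSquare i then xPow p i else 0, h1, ← Finset.sum_add_distrib]
  · refine Finset.sum_congr rfl fun i _ => ?_
    by_cases h0 : i = 0
    · simp [h0]
    · by_cases hs : IsSquare i <;> simp [h0, hs]

theorem Q_sub_N_eq_sum : Q p - N p = ∑ i : ZMod p, chi p i * xPow p i := by
  classical
  rw [Q, N, Finset.sum_filter, Finset.sum_filter, ← Finset.sum_sub_distrib]
  simp only [IsResidue, IsNonresidue, x_pow_eq_xPow]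
  rw [sum_range_eq_sum_zmod fun i => (if i ≠ 0 ∧ IsSquare i then xPow p i else 0) -
    if ¬ IsSquare i then xPow p i else 0]
  refine Finset.sum_congr rfl fun i _ => ?_
  by_cases h0 : i = 0
  · simp [h0, chi]
  · by_cases hs : IsSquare i
    · simp [h0, hs, chi, (quadraticChar_one_iff_isSquare h0).2 hs]
    · simp [hs, chi, quadraticChar_neg_one_iff_not_isSquare.2 hs]

theorem J_mul_xPow (i : ZMod p) : J p * xPow p i = J p := by
  rw [J_eq_sum, Finset.sum_mul]
  simp only [← xPow_add]
  exact Fintype.sum_equiv (Equiv.addRight i) _ _ fun _ => rfl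

theorem J_mul_J : J p * J p = p * J p := by
  conv_lhs => rw [J_eq_sum (p := p), Finset.sum_mul]; simp only [mul_comm _ (∑ i, xPow p i)]; rw [← J_eq_sum]
  simp [J_mul_xPow, ZMod.card]

theorem sum_chi (hp : p ≠ 2) : ∑ i, chi p i = 0 := by
  have h := quadraticChar_sum_zero (F := ZMod p) (by rwa [ZMod.ringChar_zmod_n])
  simp only [chi]
  rw [← Int.cast_sum, h, Int.cast_zero]

theorem J_mul_Q_sub_N (hp : p ≠ 2) : J p * (Q p - N p) = 0 := by
  rw [Q_sub_N_eq_sum, Finset.mul_sum]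
  have : ∀ i, J p * (chi p i * xPow p i) = chi p i * J p := fun i => by
    rw [mul_left_comm, J_mul_xPow]
  simp only [this]
  rw [← Finset.sum_mul, sum_chi hp, zero_mul]

theorem quadraticChar_neg_one_of_mod_four (hp : p % 4 = 3) :
    quadraticChar (ZMod p) (-1) = -1 := by
  rw [quadraticChar_neg_one_iff_not_isSquare, ZMod.exists_sq_eq_neg_one_iff, not_not]
  exact hp

/-- At k = 0, χ(-1) = -1 turns the sum into -∑ χ². Otherwise scaling i by k gives the Jacobi sum of
χ with χ = χ⁻¹, which is -χ(-1) = 1. -/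
theorem chi_convolution (hp : p % 4 = 3) (k : ZMod p) :
    ∑ i, chi p i * chi p (k - i) = if k = 0 then 1 - (p : Rn p) else 1 := by
  have h2 : ringChar (ZMod p) ≠ 2 := by rw [ZMod.ringChar_zmod_n]; omega
  have key : ∑ i, quadraticChar (ZMod p) i * quadraticChar (ZMod p) (k - i) =
      if k = 0 then 1 - (p : ℤ) else 1 := by
    split_ifs with hk
    · subst hk
      have h : ∀ i : ZMod p, quadraticChar (ZMod p) i * quadraticChar (ZMod p) (0 - i) =
          (if i = 0 then 1 else 0) - 1 := by
        intro i
        rw [zero_sub, ← neg_one_mul i, map_mul, quadraticChar_neg_one_of_mod_four hp]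
        split_ifs with hi
        · simp [hi]
        · linear_combination -quadraticChar_sq_one hi
      rw [Finset.sum_congr rfl fun i _ => h i]
      simp [ZMod.card]
    · have hJ := jacobiSum_nontrivial_inv (quadraticChar_ne_one h2)
      rw [(quadraticChar_isQuadratic (ZMod p)).inv, quadraticChar_neg_one_of_mod_four hp,
        neg_neg, jacobiSum] at hJ
      rw [← hJ]
      refine (Fintype.sum_equiv (Equiv.mulLeft₀ k hk) _ _ fun i => ?_).symm
      rw [Equiv.mulLeft₀_apply, show k - k * i = k * (1 - i) by ring, map_mul, map_mul]
      linear_combination (-quadraticChar (ZMod p) i * quadraticChar (ZMod p) (1 - i)) *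
        quadraticChar_sq_one hk
  have := congrArg (Int.cast : ℤ → Rn p) key
  simpa [chi] using this

theorem Q_sub_N_sq (hp : p % 4 = 3) : (Q p - N p) * (Q p - N p) = J p - p := by
  have h : (Q p - N p) * (Q p - N p) =
      ∑ k, (∑ i, chi p i * chi p (k - i)) * xPow p k := by
    rw [Q_sub_N_eq_sum, Finset.sum_mul_sum]
    simp only [Finset.sum_mul]
    rw [Finset.sum_comm (f := fun k i => chi p i * chi p (k - i) * xPow p k)]
    refine Finset.sum_congr rfl fun i _ => ?_
    refine Fintype.sum_equiv (Equiv.addLeft i) _ _ fun j => ?_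
    rw [Equiv.coe_addLeft, add_sub_cancel_left, xPow_add]
    ring
  have h2 : ∀ k : ZMod p, (if k = 0 then 1 - (p : Rn p) else 1) * xPow p k =
      xPow p k - if k = 0 then (p : Rn p) else 0 := by
    intro k
    split_ifs with hk
    · rw [hk, xPow_zero]; ring
    · ring
  rw [h]
  simp only [chi_convolution hp, h2]
  rw [Finset.sum_sub_distrib, ← J_eq_sum]
  simp

theorem mu_J {a : ℕ} (ha : (a : ZMod p) ≠ 0) : mu p a (J p) = J p := by
  rw [J_eq_sum, map_sum]
  simp only [mu_xPow]
  exact Fintype.sum_equiv (Equiv.mulLeft₀ (a : ZMod p) ha) _ _ fun _ => rfl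

theorem chi_mul_mu_Q_sub_N {a : ℕ} (ha : (a : ZMod p) ≠ 0) :
    chi p a * mu p a (Q p - N p) = Q p - N p := by
  rw [Q_sub_N_eq_sum, map_sum, Finset.mul_sum]
  refine Fintype.sum_equiv (Equiv.mulLeft₀ (a : ZMod p) ha) _ _ fun i => ?_
  rw [map_mul, mu_xPow, Equiv.mulLeft₀_apply, chi_mul, mul_assoc, chi, chi, map_intCast]

theorem mu_Q_and_N {a : ℕ} (ha : IsResidue p a) : mu p a (Q p) = Q p ∧ mu p a (N p) = N p := by
  have h1 := mu_J ha.1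
  have h2 := chi_mul_mu_Q_sub_N ha.1
  rw [chi_residue ha, map_sub] at h2
  rw [J, map_add, map_add, map_one] at h1
  have h9 : (9 : Rn p) = 0 := nine_eq_zero
  constructor
  -- Here 5 is the inverse of 2 modulo 9, recovering Q and N from Q + N and Q - N.
  · linear_combination 5 * h1 + 5 * h2 - (mu p a (Q p) - Q p) * h9
  · linear_combination 5 * h1 - 5 * h2 - (mu p a (N p) - N p) * h9

theorem mu_Q_and_N_swap {a : ℕ} (ha : IsNonresidue p a) :
    mu p a (Q p) = N p ∧ mu p a (N p) = Q p := by
  have ha0 : (a : ZMod p) ≠ 0 := fun h => ha (by rw [h]; exact IsSquare.zero)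
  have h1 := mu_J ha0
  have h2 := chi_mul_mu_Q_sub_N ha0
  rw [chi_nonresidue ha, map_sub] at h2
  rw [J, map_add, map_add, map_one] at h1
  have h9 : (9 : Rn p) = 0 := nine_eq_zero
  constructor
  · linear_combination 5 * h1 - 5 * h2 - (mu p a (Q p) - N p) * h9
  · linear_combination 5 * h1 + 5 * h2 - (mu p a (N p) - Q p) * h9

end GaussSum

/-! ### The idempotents and sizes of the codes -/

section Codes
variable {p : ℕ}

theorem uu_mul_uu (p : ℕ) : uu p * uu p = uu p := by
  have h : u * u = u := by
    ext <;> simp [u]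
  rw [uu, ← map_mul, h]

theorem mu_dBlock {a : ℕ} (r : ℕ) (A B : Rn p) :
    mu p a (dBlock r A B) = dBlock r (mu p a A) (mu p a B) := by
  unfold dBlock
  split_ifs <;> simp only [map_add, map_mul, map_ofNat]

theorem eBlock_eq (r : ℕ) (A B : Rn p) : eBlock r A B = 1 - dBlock r B A := by
  have h9 : (9 : Rn p) = 0 := nine_eq_zero
  unfold dBlock eBlock
  split_ifs
  · linear_combination B * h9
  · linear_combination (A + B + 1) * h9
  · linear_combination (A + B + 1) * h9

theorem e₁_eq (r : ℕ) : e₁ p r = 1 - d₂ p r := by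
  rw [e₁, d₂, eBlock_eq, eBlock_eq]; ring

theorem e₂_eq (r : ℕ) : e₂ p r = 1 - d₁ p r := by
  rw [e₂, d₁, eBlock_eq, eBlock_eq]; ring

variable [Fact p.Prime]

theorem dBlock_relations {r : ℕ} (hr : p + 1 = 12 * r) :
    ∃ c c' : ℕ, (c = 2 ∨ c = 5 ∨ c = 8) ∧ (c * c' : R) = 1 ∧
      dBlock r (Q p) (N p) * dBlock r (Q p) (N p) = dBlock r (Q p) (N p) ∧
      dBlock r (N p) (Q p) * dBlock r (N p) (Q p) = dBlock r (N p) (Q p) ∧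
      dBlock r (Q p) (N p) * dBlock r (N p) (Q p) = c * J p ∧
      dBlock r (Q p) (N p) + dBlock r (N p) (Q p) = 1 + c * J p := by
  have h9 : (9 : Rn p) = 0 := nine_eq_zero
  have h9' : (9 : R) = 0 := nine_eq_zero
  have hJJ := J_mul_J (p := p)
  have hJT := J_mul_Q_sub_N (p := p) (by omega)
  have hTT := Q_sub_N_sq (p := p) (by omega)
  have hJ : J p = 1 + Q p + N p := rfl
  have hp : (p : Rn p) + 1 = 12 * r := by exact_mod_cast congrArg (Nat.cast : ℕ → Rn p) hr
  -- As 36 = 0, the residue of r mod 3 determines p = 12r - 1 in `Rn p`.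
  have hr3 : (r : Rn p) = 3 * (r / 3 : ℕ) + (r % 3 : ℕ) := by
    exact_mod_cast congrArg (Nat.cast : ℕ → Rn p) (Nat.div_add_mod r 3).symm
  generalize hk : ((r / 3 : ℕ) : Rn p) = k at hr3
  generalize hT : Q p - N p = T at hJT hTT
  generalize (p : Rn p) = P at hp hJJ hTT
  have hQ : Q p = 5 * (J p - 1 + T) := by linear_combination 5 * hT - 5 * hJ - Q p * h9
  have hN : N p = 5 * (J p - 1 - T) := by linear_combination -5 * hT - 5 * hJ - N p * h9
  rw [hQ, hN]
  generalize J p = j at *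
  have h3 : r % 3 = 0 ∨ r % 3 = 1 ∨ r % 3 = 2 := by omega
  unfold dBlock
  have key : ∀ (c : ℕ) (t a b : Rn p), c * P = 1 → t * t = -c → a = 5 * (1 + c * j + t * T) →
      b = 5 * (1 + c * j - t * T) → a * a = a ∧ b * b = b ∧ a * b = c * j ∧ a + b = 1 + c * j := by
    intro c t a b hc ht ha hb
    subst ha hb
    refine ⟨?_, ?_, ?_, ?_⟩
    · linear_combination 25 * c ^ 2 * hJJ + 25 * t ^ 2 * hTT + 50 * c * t * hJT + 25 * c * j * hc +
        25 * (j - P) * ht + 25 * hc + 5 * (1 + c * j + t * T) * h9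
    · linear_combination 25 * c ^ 2 * hJJ + 25 * t ^ 2 * hTT - 50 * c * t * hJT + 25 * c * j * hc +
        25 * (j - P) * ht + 25 * hc + 5 * (1 + c * j - t * T) * h9
    · linear_combination 25 * c ^ 2 * hJJ - 25 * t ^ 2 * hTT + 25 * c * j * hc -
        25 * (j - P) * ht - 25 * hc + 11 * c * j * h9
    · linear_combination (1 + c * j) * h9
  rcases h3 with h | h | h <;> rw [h] at hr3 <;> push_cast at hr3 <;>
    simp only [h, ↓reduceIte, OfNat.ofNat_ne_zero, one_ne_zero, OfNat.ofNat_ne_one]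
  -- In each case c' = p mod 9 and c is its inverse; t is the root of -c whose sign matches the
  -- order of A and B in `dBlock`.
  · have hP : P = -1 := by linear_combination hp + 12 * hr3 + 4 * k * h9
    refine ⟨8, 8, Or.inr (Or.inr rfl), ?_, key 8 (-1) _ _ ?_ ?_ ?_ ?_⟩ <;> push_cast
    · linear_combination 7 * h9'
    · linear_combination 8 * hP - h9
    · linear_combination h9
    · linear_combination (5 * T - 5) * h9
    · linear_combination (-5 * T - 5) * h9
  · have hP : P = 2 := by linear_combination hp + 12 * hr3 + (4 * k + 1) * h9
    refine ⟨5, 2, Or.inr (Or.inl rfl), ?_, key 5 (-2) _ _ ?_ ?_ ?_ ?_⟩ <;> push_cast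
    · linear_combination h9'
    · linear_combination 5 * hP + h9
    · linear_combination h9
    · linear_combination (5 * j - 8) * h9
    · linear_combination (5 * j - 8) * h9
  · have hP : P = 5 := by linear_combination hp + 12 * hr3 + (4 * k + 2) * h9
    refine ⟨2, 5, Or.inl rfl, ?_, key 2 4 _ _ ?_ ?_ ?_ ?_⟩ <;> push_cast
    · linear_combination h9'
    · linear_combination 2 * hP + h9
    · linear_combination 2 * h9
    · linear_combination (5 * j - 6 - 5 * T) * h9
    · linear_combination (5 * j - 6 + 5 * T) * h9

/-- The four idempotent identities behind all the assertions about the codes. -/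
theorem d_relations {r : ℕ} (hr : p + 1 = 12 * r) :
    ∃ c c' : ℕ, (c = 2 ∨ c = 5 ∨ c = 8) ∧ (c * c' : R) = 1 ∧
      d₁ p r * d₁ p r = d₁ p r ∧ d₂ p r * d₂ p r = d₂ p r ∧
      d₁ p r * d₂ p r = c * J p ∧ d₁ p r + d₂ p r = 1 + c * J p := by
  obtain ⟨c, c', hc, hcc, h1, h2, h3, h4⟩ := dBlock_relations hr
  have hu := uu_mul_uu p
  refine ⟨c, c', hc, hcc, ?_⟩
  unfold d₁ d₂
  generalize dBlock r (Q p) (N p) = a at *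
  generalize dBlock r (N p) (Q p) = b at *
  generalize uu p = v at *
  refine ⟨?_, ?_, ?_, ?_⟩
  · linear_combination v * h1 + (1 - v) * h2 + (a - b) ^ 2 * hu
  · linear_combination v * h2 + (1 - v) * h1 + (a - b) ^ 2 * hu
  · linear_combination h3 - (a - b) ^ 2 * hu
  · linear_combination h4

theorem mu_d_residue {a : ℕ} (ha : IsResidue p a) (r : ℕ) :
    mu p a (d₁ p r) = d₁ p r ∧ mu p a (d₂ p r) = d₂ p r := by
  obtain ⟨h1, h2⟩ := mu_Q_and_N ha
  simp only [d₁, d₂, map_add, map_sub, map_mul, map_one, mu_uu, mu_dBlock, h1, h2, and_self]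

theorem mu_d_nonresidue {a : ℕ} (ha : IsNonresidue p a) (r : ℕ) :
    mu p a (d₁ p r) = d₂ p r ∧ mu p a (d₂ p r) = d₁ p r := by
  obtain ⟨h1, h2⟩ := mu_Q_and_N_swap ha
  simp only [d₁, d₂, map_add, map_sub, map_mul, map_one, mu_uu, mu_dBlock, h1, h2, and_self]

theorem mu_surjective {a : ℕ} (ha : (a : ZMod p) ≠ 0) : Function.Surjective (mu p a) := by
  intro z
  refine ⟨mu p ((a : ZMod p)⁻¹).val z, mu_mu (NeZero.ne p) ?_ z⟩
  rw [ZMod.natCast_zmod_val, mul_inv_cancel₀ ha]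

theorem image_span {a : ℕ} (ha : (a : ZMod p) ≠ 0) (e : Rn p) :
    image a (Ideal.span {e}) = (Ideal.span {mu p a e} : Ideal (Rn p)) := by
  ext z
  simp only [image, Set.mem_image, SetLike.mem_coe, Ideal.mem_span_singleton']
  constructor
  · rintro ⟨_, ⟨b, rfl⟩, rfl⟩
    exact ⟨mu p a b, (map_mul _ _ _).symm⟩
  · rintro ⟨b, rfl⟩
    obtain ⟨b, rfl⟩ := mu_surjective ha b
    exact ⟨b * e, ⟨b, rfl⟩, map_mul _ _ _⟩

theorem card_span_mu {a : ℕ} (ha : (a : ZMod p) ≠ 0) (e : Rn p) :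
    Nat.card (Ideal.span {mu p a e}) = Nat.card (Ideal.span {e}) := by
  have h := image_span ha e
  have hinj : Function.Injective (mu p a) :=
    Finite.injective_iff_surjective.2 (mu_surjective ha)
  change Nat.card ((Ideal.span {mu p a e} : Ideal (Rn p)) : Set (Rn p)) = _
  rw [← h, image, Nat.card_image_of_injective hinj]
  rfl

theorem constCoeff_J : constCoeff p (J p) = 1 := by
  rw [J_eq_sum, map_sum]
  simp [xPow, constCoeff_x_pow]

theorem phi_mul_J (w : Fin p → R) : phi p w * J p = (∑ i, w i) • J p := by
  rw [phi, Finset.sum_mul, Finset.sum_smul]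
  refine Finset.sum_congr rfl fun i _ => ?_
  rw [x_pow_eq_xPow, mul_assoc, mul_comm (xPow p _), J_mul_xPow, Algebra.smul_def]

/-- A word multiplies J by its coordinate sum, so the ideal is R·cJ; it is free because c is a unit
and J has constant coefficient 1. -/
theorem card_span_mul_J (p : ℕ) [Fact p.Prime] {c c' : ℕ} (hc : (c * c' : R) = 1) :
    Nat.card (Ideal.span {(c : Rn p) * J p}) = 81 := by
  rw [← card_R]
  refine (Nat.card_congr (Equiv.ofBijective (fun s : R =>
    (⟨s • ((c : Rn p) * J p), Submodule.smul_of_tower_mem _ s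
      (Ideal.mem_span_singleton_self _)⟩ : Ideal.span {(c : Rn p) * J p})) ⟨?_, ?_⟩)).symm
  · intro s t h
    have h1 := congrArg (constCoeff p) (congrArg Subtype.val h)
    simp only [← nsmul_eq_mul, map_smul, map_nsmul, constCoeff_J] at h1
    simp only [nsmul_eq_mul, smul_eq_mul, mul_one] at h1
    linear_combination (c' : R) * h1 - (s - t) * hc
  · rintro ⟨z, hz⟩
    obtain ⟨b, rfl⟩ := Ideal.mem_span_singleton'.1 hz
    obtain ⟨w, rfl⟩ := (phi_bijective p).2 b
    refine ⟨∑ i, w i, Subtype.ext ?_⟩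
    change _ = phi p w * (c * J p)
    rw [mul_left_comm, phi_mul_J, mul_smul_comm]

theorem isNonresidue_pred (hp : p % 4 = 3) : IsNonresidue p (p - 1) := by
  rw [IsNonresidue, Nat.cast_sub (NeZero.one_le), ZMod.natCast_self, Nat.cast_one, zero_sub,
    ZMod.exists_sq_eq_neg_one_iff, not_not]
  exact hp

theorem IsNonresidue.ne_zero {a : ℕ} (ha : IsNonresidue p a) : (a : ZMod p) ≠ 0 :=
  fun h => ha (by rw [h]; exact IsSquare.zero)

theorem card_codes {r c c' : ℕ} (hr : p + 1 = 12 * r) (hcc : (c * c' : R) = 1)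
    (h1 : d₁ p r * d₁ p r = d₁ p r) (h2 : d₂ p r * d₂ p r = d₂ p r)
    (h3 : d₁ p r * d₂ p r = c * J p) (h4 : d₁ p r + d₂ p r = 1 + c * J p) :
    Nat.card (D₁ p r) = 9 ^ (p + 1) ∧ Nat.card (D₂ p r) = 9 ^ (p + 1) ∧
      Nat.card (E₁ p r) = 9 ^ (p - 1) ∧ Nat.card (E₂ p r) = 9 ^ (p - 1) := by
  have hm := isNonresidue_pred (p := p) (by omega)
  obtain ⟨m1, m2⟩ := mu_d_nonresidue hm r
  have hD : Nat.card (D₂ p r) = Nat.card (D₁ p r) := by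
    rw [D₁, D₂, ← m1, card_span_mu hm.ne_zero]
  have hE : Nat.card (E₂ p r) = Nat.card (E₁ p r) := by
    rw [E₁, E₂, e₁_eq, e₂_eq, ← m1, ← map_one (mu p (p - 1)), ← map_sub, card_span_mu hm.ne_zero,
      map_one]
  have hK : (c * J p) * (c * J p) = c * J p := by
    rw [← h3]; linear_combination d₂ p r * d₂ p r * h1 + d₁ p r * h2
  have s1 : Nat.card (D₁ p r) = Nat.card (E₁ p r) * 81 := by
    rw [← card_span_mul_J p hcc, E₁, ← card_span_add _ hK, e₁_eq, D₁,
      show d₁ p r = 1 - d₂ p r + c * J p by linear_combination h4]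
    · rw [e₁_eq, ← h3]; linear_combination -d₁ p r * h2
    · rw [e₁_eq]; linear_combination h2
  have s2 : Nat.card (E₁ p r) * Nat.card (D₂ p r) = 81 ^ p := by
    rw [← card_Rn p, E₁, D₂, ← card_span_add _ h2, e₁_eq, sub_add_cancel, Ideal.span_singleton_one]
    · exact Nat.card_congr (Equiv.Set.univ _)
    · rw [e₁_eq]; linear_combination -h2
    · rw [e₁_eq]; linear_combination h2
  obtain ⟨k, hk⟩ : ∃ k, p = k + 1 := ⟨p - 1, by omega⟩
  -- The two decompositions and |D₂| = |D₁| give |E₁|² · 81 = 81^p.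
  have hE9 : Nat.card (E₁ p r) = 9 ^ k := by
    rw [hD, s1] at s2
    refine Nat.pow_left_injective (n := 2) two_ne_zero ?_
    have h81 : (81 : ℕ) ^ p = (9 ^ k) ^ 2 * 81 := by
      rw [hk, pow_succ, ← pow_mul, mul_comm k 2, pow_mul]
      norm_num
    rw [h81] at s2
    change _ ^ 2 = _ ^ 2
    nlinarith
  have e1 : p - 1 = k := by omega
  have e2 : p + 1 = k + 2 := by omega
  rw [hD, hE, s1, hE9, e1, e2, pow_add]
  norm_num

end Codes
end QRCode
end

theorem theorem5 (p r : ℕ) (hp : p.Prime) (hr : p + 1 = 12 * r) :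
    -- the generators are idempotents
    (IsIdempotentElem (QRCode.d₁ p r) ∧ IsIdempotentElem (QRCode.d₂ p r) ∧
      IsIdempotentElem (QRCode.e₁ p r) ∧ IsIdempotentElem (QRCode.e₂ p r)) ∧
    -- (i)
    (∀ a : ℕ, QRCode.IsResidue p a →
      QRCode.image a (QRCode.D₁ p r) = QRCode.D₁ p r ∧
      QRCode.image a (QRCode.D₂ p r) = QRCode.D₂ p r ∧
      QRCode.image a (QRCode.E₁ p r) = QRCode.E₁ p r ∧
      QRCode.image a (QRCode.E₂ p r) = QRCode.E₂ p r) ∧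
    (∀ a : ℕ, QRCode.IsNonresidue p a →
      QRCode.image a (QRCode.D₁ p r) = QRCode.D₂ p r ∧
      QRCode.image a (QRCode.D₂ p r) = QRCode.D₁ p r ∧
      QRCode.image a (QRCode.E₁ p r) = QRCode.E₂ p r ∧
      QRCode.image a (QRCode.E₂ p r) = QRCode.E₁ p r) ∧
    -- (ii), (iii) and (v), with one and the same `K`
    (∃ K : QRCode.Rn p,
      K ∈ ({2 * QRCode.J p, 5 * QRCode.J p, 8 * QRCode.J p} : Set (QRCode.Rn p)) ∧
      (QRCode.D₁ p r ⊓ QRCode.D₂ p r = Ideal.span {K} ∧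
        QRCode.D₁ p r + QRCode.D₂ p r = ⊤) ∧
      (QRCode.E₁ p r ⊓ QRCode.E₂ p r = ⊥ ∧
        ((QRCode.E₁ p r + QRCode.E₂ p r : Ideal (QRCode.Rn p)) : Set (QRCode.Rn p)) =
          QRCode.dual (Ideal.span {K} : Ideal (QRCode.Rn p))) ∧
      (QRCode.D₁ p r = QRCode.E₁ p r + Ideal.span {K} ∧
        QRCode.D₂ p r = QRCode.E₂ p r + Ideal.span {K})) ∧
    -- (iv)
    (Nat.card (QRCode.D₁ p r) = 9 ^ (p + 1) ∧ Nat.card (QRCode.D₂ p r) = 9 ^ (p + 1) ∧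
      Nat.card (QRCode.E₁ p r) = 9 ^ (p - 1) ∧ Nat.card (QRCode.E₂ p r) = 9 ^ (p - 1)) ∧
    -- (vi)
    (((QRCode.E₁ p r : Set (QRCode.Rn p)) ⊆ QRCode.dual (QRCode.E₁ p r)) ∧
      ((QRCode.E₂ p r : Set (QRCode.Rn p)) ⊆ QRCode.dual (QRCode.E₂ p r)) ∧
      QRCode.dual (QRCode.E₁ p r : Set (QRCode.Rn p)) = QRCode.D₁ p r ∧
      QRCode.dual (QRCode.E₂ p r : Set (QRCode.Rn p)) = QRCode.D₂ p r) := by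
  have : Fact p.Prime := ⟨hp⟩
  obtain ⟨c, c', hc, hcc, h1, h2, h3, h4⟩ := QRCode.d_relations hr
  have hcard := QRCode.card_codes hr hcc h1 h2 h3 h4
  have hm := QRCode.isNonresidue_pred (p := p) (by omega)
  obtain ⟨m1, m2⟩ := QRCode.mu_d_nonresidue hm r
  have hJm := QRCode.mu_J hm.ne_zero
  have f1 := QRCode.e₁_eq (p := p) r
  have f2 := QRCode.e₂_eq (p := p) r
  have g1 : QRCode.e₁ p r * QRCode.e₁ p r = QRCode.e₁ p r := by
    rw [f1]; linear_combination h2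
  have g2 : QRCode.e₂ p r * QRCode.e₂ p r = QRCode.e₂ p r := by
    rw [f2]; linear_combination h1
  have g12 : QRCode.e₁ p r * QRCode.e₂ p r = 0 := by
    rw [f1, f2]; linear_combination h3 - h4
  have hK : (c * QRCode.J p) * (c * QRCode.J p) = c * QRCode.J p := by
    rw [← h3]; linear_combination QRCode.d₂ p r * QRCode.d₂ p r * h1 + QRCode.d₁ p r * h2
  have dual1 : QRCode.dual (QRCode.E₁ p r : Set (QRCode.Rn p)) = QRCode.D₁ p r := by
    rw [QRCode.E₁, QRCode.dual_span_idem g1 (f := QRCode.e₂ p r), f2, sub_sub_cancel, QRCode.D₁]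
    rw [f1, f2, map_sub, map_one, m2]
  have dual2 : QRCode.dual (QRCode.E₂ p r : Set (QRCode.Rn p)) = QRCode.D₂ p r := by
    rw [QRCode.E₂, QRCode.dual_span_idem g2 (f := QRCode.e₁ p r), f1, sub_sub_cancel, QRCode.D₂]
    rw [f1, f2, map_sub, map_one, m1]
  refine ⟨⟨h1, h2, g1, g2⟩, fun a ha => ?_, fun a ha => ?_,
    ⟨c * QRCode.J p, ?_, ⟨?_, ?_⟩, ⟨?_, ?_⟩, ⟨?_, ?_⟩⟩, hcard, ?_, ?_, dual1, dual2⟩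
  · obtain ⟨k1, k2⟩ := QRCode.mu_d_residue ha r
    simp only [QRCode.D₁, QRCode.D₂, QRCode.E₁, QRCode.E₂, QRCode.image_span ha.1, f1, f2,
      map_sub, map_one, k1, k2, and_self]
  · obtain ⟨k1, k2⟩ := QRCode.mu_d_nonresidue ha r
    simp only [QRCode.D₁, QRCode.D₂, QRCode.E₁, QRCode.E₂, QRCode.image_span ha.ne_zero, f1, f2,
      map_sub, map_one, k1, k2, and_self]
  · rcases hc with rfl | rfl | rfl <;> simp
  · rw [QRCode.D₁, QRCode.D₂, QRCode.span_inf_span_idem h1 h2, h3]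
  · rw [Ideal.eq_top_iff_one, Submodule.add_eq_sup]
    -- Equivalently (1 - d₁)(1 - d₂) = 0.
    have : (1 : QRCode.Rn p) = QRCode.d₁ p r + (1 - QRCode.d₁ p r) * QRCode.d₂ p r := by
      linear_combination h3 - h4
    rw [this]
    exact Submodule.add_mem_sup (Ideal.mem_span_singleton_self _)
      (Ideal.mul_mem_left _ _ (Ideal.mem_span_singleton_self _))
  · rw [QRCode.E₁, QRCode.E₂, QRCode.span_inf_span_idem g1 g2, g12, Ideal.span_singleton_eq_bot]
  · rw [QRCode.dual_span_idem hK (f := (c : QRCode.Rn p) * QRCode.J p) (by rw [map_mul, map_natCast, hJm]),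
      QRCode.E₁, QRCode.E₂, QRCode.span_sup_span_idem g1 g2 g12]
    -- It remains to see e₁ + e₂ = 2 - (d₁ + d₂) = 1 - K.
    congr 3
    rw [f1, f2]
    linear_combination -h4
  · rw [QRCode.D₁, QRCode.E₁, QRCode.span_sup_span_idem g1 hK]
    · congr 2
      rw [f1]; linear_combination h4
    · rw [f1, ← h3]; linear_combination -QRCode.d₁ p r * h2
  · rw [QRCode.D₂, QRCode.E₂, QRCode.span_sup_span_idem g2 hK]
    · congr 2
      rw [f2]; linear_combination h4
    · rw [f2, ← h3]; linear_combination -QRCode.d₂ p r * h1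
  · rw [dual1, SetLike.coe_subset_coe, QRCode.E₁, Ideal.span_singleton_le_iff_mem, QRCode.D₁,
      QRCode.mem_span_idem_iff h1]
    -- Containment amounts to e₁d₁ = e₁, that is e₁e₂ = 0.
    rw [f2] at g12
    linear_combination -g12
  · rw [dual2, SetLike.coe_subset_coe, QRCode.E₂, Ideal.span_singleton_le_iff_mem, QRCode.D₂,
      QRCode.mem_span_idem_iff h2]
    rw [f1] at g12
    linear_combination -g12
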